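/- Let $\mathcal H$ be a finite-dimensional complex Hilbert space, let $\log$ denote the logarithm to base $2$, and let $\|X\|_1=\operatorname{tr}\sqrt{X^\dagger X}$. Let $\mathcal P$ be the set of positive semidefinite operators on $\mathcal H$, $\mathcal S_\bullet=\{\rho\in\mathcal P: 0<\operatorname{tr}\rho\le 1\}$ the set of sub-normalized states and $\mathcal S=\{\rho\in\mathcal P:\operatorname{tr}\rho=1\}$ the set of normalized states. For $\rho,\tau\in\mathcal S_\bullet$ let $T(\rho,\tau)=\tfrac12\|\rho-\tau\|_1$ be the trace distance and let $$P(\rho,\tau)=\sqrt{1-\bar F(\rho,\tau)},\qquad \bar F(\rho,\tau)=\Big(\|\sqrt\rho\sqrt\tau\|_1+\sqrt{(1-\operatorname{tr}\rho)(1-\operatorname{tr}\tau)}\Big)^2,$$ be the purified distance. For $\rho\in\mathcal S_\bullet$ and $\sigma\in\mathcal P$ let $$D_{\max}(\rho\|\sigma)=\inf\{\lambda\in\mathbb R:\rho\le 2^\lambda\sigma\}\in(-\infty,+\infty],$$ with $\inf\emptyset=+\infty$, and for $\varepsilon\in(0,1)$ let, with infima taken in $[-\infty,+\infty]$, $$D_{\max}^{\varepsilon,P}(\rho\|\sigma)=\inf\{D_{\max}(\tilde\rho\|\sigma):\tilde\rho\in\mathcal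 S_\bullet,\ P(\rho,\tilde\rho)\le\varepsilon\},\qquad D_{\max}^{\varepsilon,T}(\rho\|\sigma)=\inf\{D_{\max}(\tilde\rho\|\sigma):\tilde\rho\in\mathcal S,\ T(\rho,\tilde\rho)\le\varepsilon\}.$$ For $\alpha>1$ let the sandwiched Rényi divergence be $$\widetilde D_\alpha(\rho\|\sigma)=\frac1{\alpha-1}\log\frac{\operatorname{tr}\big(\sigma^{\frac{1-\alpha}{2\alpha}}\rho\,\sigma^{\frac{1-\alpha}{2\alpha}}\big)^\alpha}{\operatorname{tr}\rho}$$ if the support of $\rho$ is contained in the support of $\sigma$ (negative powers of $\sigma$ being taken on its support), and $\widetilde D_\alpha(\rho\|\sigma)=+\infty$ otherwise. Theorem. Let $\rho\in\mathcal S_\bullet$ and $\sigma\in\mathcal P$. For all $\varepsilon\in(0,1)$ and $\alpha>1$, $$D_{\max}^{\varepsilon,P}(\rho\|\sigma)\le\widetilde D_\alpha(\rho\|\sigma)+\frac1{\alpha-1}\log\frac1{\varepsilon^2}+\log\frac1{1-\varepsilon^2}.$$ If moreover $\rho\in\mathcal S$, then also $$D_{\max}^{\varepsilon,T}(\rho\|\sigma)\le\widetilde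 D_\alpha(\rho\|\sigma)+\frac1{\alpha-1}\log\frac1{\varepsilon^2}+\log\frac1{1-\varepsilon^2}.$$ -/

import Mathlib

/-!
Operators on a finite-dimensional complex Hilbert space are square complex matrices
indexed by an arbitrary finite type `ι`.  All logarithms are to base `2`, and
divergences take values in the extended real numbers `EReal`.
-/

open scoped ComplexOrder

namespace QDiv

noncomputable section

/-- The (real part of the) trace; for Hermitian matrices this is the trace itself. -/
def tr {ι : Type*} [Fintype ι] (A : Matrix ι ι ℂ) : ℝ := A.trace.re

/-- Sub-normalized states: `ρ ≥ 0` and `0 < tr ρ ≤ 1`. -/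
def IsSubState {ι : Type*} [Fintype ι] (ρ : Matrix ι ι ℂ) : Prop :=
  ρ.PosSemidef ∧ 0 < tr ρ ∧ tr ρ ≤ 1

/-- Normalized states: `ρ ≥ 0` and `tr ρ = 1`. -/
def IsState {ι : Type*} [Fintype ι] (ρ : Matrix ι ι ℂ) : Prop :=
  ρ.PosSemidef ∧ tr ρ = 1

/-- The power `A ^ s` of a positive semidefinite matrix `A`, for a real exponent `s ≠ 0`, by
functional calculus.  Since `(0 : ℝ) ^ s = 0` for every `s ≠ 0`, it vanishes on the kernel
of `A`; for negative `s` it is thus taken with respect to the Moore-Penrose inverse. -/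
def mpow {ι : Type*} [Fintype ι] [DecidableEq ι] (A : Matrix ι ι ℂ) (s : ℝ) :
    Matrix ι ι ℂ :=
  cfc (fun x : ℝ => x ^ s) A

/-- The positive square root of a positive semidefinite matrix. -/
def msqrt {ι : Type*} [Fintype ι] [DecidableEq ι] (A : Matrix ι ι ℂ) : Matrix ι ι ℂ :=
  cfc Real.sqrt A

open scoped Matrix in
/-- The trace norm `‖X‖₁ = tr √(X† X)`. -/
def traceNorm {ι : Type*} [Fintype ι] [DecidableEq ι] (X : Matrix ι ι ℂ) : ℝ :=
  tr (msqrt (Xᴴ * X))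

/-- The trace distance `T(ρ, σ) = ½ ‖ρ - σ‖₁`. -/
def traceDist {ι : Type*} [Fintype ι] [DecidableEq ι] (ρ σ : Matrix ι ι ℂ) : ℝ :=
  1 / 2 * traceNorm (ρ - σ)

/-- The generalized fidelity
`(‖√ρ √σ‖₁ + √((1 - tr ρ)(1 - tr σ)))²` of sub-normalized states. -/
def genFidelity {ι : Type*} [Fintype ι] [DecidableEq ι] (ρ σ : Matrix ι ι ℂ) : ℝ :=
  (traceNorm (msqrt ρ * msqrt σ) + Real.sqrt ((1 - tr ρ) * (1 - tr σ))) ^ 2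

/-- The purified distance of sub-normalized states. -/
def purifiedDist {ι : Type*} [Fintype ι] [DecidableEq ι] (ρ σ : Matrix ι ι ℂ) : ℝ :=
  Real.sqrt (1 - genFidelity ρ σ)

/-- The normalized states that are `ε`-close to `ρ` in trace distance. -/
def ballT {ι : Type*} [Fintype ι] [DecidableEq ι] (ε : ℝ) (ρ : Matrix ι ι ℂ) :
    Set (Matrix ι ι ℂ) :=
  {τ | IsState τ ∧ traceDist ρ τ ≤ ε}

/-- The sub-normalized states that are `ε`-close to `ρ` in purified distance. -/
def ballP {ι : Type*} [Fintype ι] [DecidableEq ι] (ε : ℝ) (ρ : Matrix ι ι ℂ) :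
    Set (Matrix ι ι ℂ) :=
  {τ | IsSubState τ ∧ purifiedDist ρ τ ≤ ε}

/-- The max-divergence: the infimum of the real `l` such that `ρ ≤ 2 ^ l σ` in the Löwner
order.  It is `⊤` if there is no such `l`. -/
def dMax {ι : Type*} [Fintype ι] (ρ σ : Matrix ι ι ℂ) : EReal :=
  ⨅ (l : ℝ) (_ : ((2 : ℝ) ^ l • σ - ρ).PosSemidef), (l : EReal)

/-- The max-divergence smoothed over a set `B` of operators. -/
def dMaxOn {ι : Type*} [Fintype ι] (B : Set (Matrix ι ι ℂ)) (σ : Matrix ι ι ℂ) : EReal :=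
  ⨅ τ ∈ B, dMax τ σ

/-- The smooth max-divergence for the purified distance. -/
def dMaxP {ι : Type*} [Fintype ι] [DecidableEq ι] (ε : ℝ) (ρ σ : Matrix ι ι ℂ) : EReal :=
  dMaxOn (ballP ε ρ) σ

/-- The smooth max-divergence for the trace distance. -/
def dMaxT {ι : Type*} [Fintype ι] [DecidableEq ι] (ε : ℝ) (ρ σ : Matrix ι ι ℂ) : EReal :=
  dMaxOn (ballT ε ρ) σ

/-- For Hermitian `ρ` and `σ`: the support (the orthogonal complement of the kernel) of `ρ` is
contained in the support of `σ`. -/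
def SuppLE {ι : Type*} [Fintype ι] (ρ σ : Matrix ι ι ℂ) : Prop :=
  LinearMap.ker σ.mulVecLin ≤ LinearMap.ker ρ.mulVecLin

open scoped Classical in
/-- The sandwiched Rényi divergence of order `α > 1`,
`1/(α-1) log (tr (σ^((1-α)/(2α)) ρ σ^((1-α)/(2α)))^α / tr ρ)` if the support of `ρ` is
contained in that of `σ`, and `⊤` otherwise. -/
def sandwichedRenyi {ι : Type*} [Fintype ι] [DecidableEq ι] (α : ℝ) (ρ σ : Matrix ι ι ℂ) :
    EReal :=
  if SuppLE ρ σ then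
    ((1 / (α - 1) * Real.logb 2
      (tr (mpow (mpow σ ((1 - α) / (2 * α)) * ρ * mpow σ ((1 - α) / (2 * α))) α) / tr ρ) : ℝ) :
      EReal)
  else ⊤

end

end QDiv

/-!
Put `r = tr ρ` and let `Q` be the trace inside the sandwiched Rényi divergence, and choose `m` with
`m ^ (α - 1) = Q / (ε² r)`. Taking logarithms of `m / (1 - ε²)` gives the right-hand side of both
bounds, so it suffices to find one `τ` in the smoothing ball with `τ ≤ m / (1 - ε²) σ`.

*Minimax.* The `τ` of trace `r` for which some block matrix `[[ρ, X], [Xᴴ, τ]] ≥ 0` has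
`Re tr X ≥ r √(1 - ε²)` form a convex compact set (`couplingBall`). By the Hahn-Banach theorem
(`exists_le_of_forall_tr_mul_le`) it is enough to find, for every single test `W ≥ 0`, an element
`τ` of this set with `tr W τ ≤ m / (1 - ε²) tr W σ`. In an eigenbasis of `W`, let `E` be the
projection onto the eigenvectors on which the expectation of `ρ` is at most `m` times that of `σ`.
Then `τ = (r / tr E ρ) E ρ E` works, with `X = √(r / tr E ρ) ρ E`, as soon as
`tr (1 - E) ρ ≤ ε² r` (`exists_mem_couplingBall`).

*Tail bound.* For `B = 1 - E` one has `tr B ρ ≥ m tr B σ`, and `tr B ρ ≤ m ^ (-(α - 1)) Q` follows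
from data processing of the sandwiched Rényi divergence under a projective test. With
`β = α / (α - 1)` and `Z = σ^(-1/(2β)) ρ σ^(-1/(2β))`, the expectation `tr B ρ` is
`tr Z K` for `K = σ^(1/(2β)) B σ^(1/(2β))`. Young's inequality bounds it by `tr Z^α = Q` and
`tr K^β`; the latter equals `tr (B σ^(1/β) B)^β`, which Jensen's inequality bounds by `tr B σ`
(`tr_mul_le_sandwichedTrace`, `tr_mpow_compression_le`).

*Distances.* A coupling `X` satisfies `Re tr X ≤ ‖√ρ √τ‖₁` (`IsCoupling.tr_le_traceNorm`) and, for
normalized states, `T(ρ, τ) ≤ √(1 - (Re tr X)²)` (`IsCoupling.traceDist_le`); hence the set above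
lies in both smoothing balls.
-/

namespace QDiv

open Matrix

/-! ### Traces and spectral calculus -/

section

theorem re_diag_nonneg {ι : Type*} {A : Matrix ι ι ℂ} (hA : A.PosSemidef) (j : ι) :
    0 ≤ (A j j).re :=
  (Complex.le_def.1 hA.diag_nonneg).1

variable {ι : Type*} [Fintype ι]

theorem tr_add (A B : Matrix ι ι ℂ) : tr (A + B) = tr A + tr B := by
  simp [tr]

theorem tr_smul (c : ℝ) (A : Matrix ι ι ℂ) : tr (c • A) = c * tr A := by
  simp [tr]

theorem tr_mul_comm (A B : Matrix ι ι ℂ) : tr (A * B) = tr (B * A) := by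
  simp [tr, Matrix.trace_mul_comm A B]

theorem tr_conjTranspose (A : Matrix ι ι ℂ) : tr Aᴴ = tr A := by
  simp [tr, Matrix.trace_conjTranspose]

theorem tr_nonneg {A : Matrix ι ι ℂ} (hA : A.PosSemidef) : 0 ≤ tr A :=
  (Complex.le_def.1 hA.trace_nonneg).1

theorem diag_conjTranspose_mul_self (A : Matrix ι ι ℂ) (j : ι) :
    ((Aᴴ * A) j j).re = ∑ l, ‖A l j‖ ^ 2 := by
  simp [Matrix.mul_apply, Complex.sq_norm, Complex.normSq_apply]

/-- Jensen's inequality for the power `b` and a subprobability vector `w`. -/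
theorem sum_mul_rpow_le {b : ℝ} (hb : 1 < b) (w s : ι → ℝ) (hw : ∀ i, 0 ≤ w i) (hs : ∀ i, 0 ≤ s i)
    (h1 : ∑ i, w i ≤ 1) : (∑ i, s i ^ (1 / b) * w i) ^ b ≤ ∑ i, s i * w i := by
  have hb0 : 0 < b := by linarith
  have key := Real.inner_le_weight_mul_Lp_of_nonneg Finset.univ hb.le w (fun i => s i ^ (1 / b)) hw
    (fun i => Real.rpow_nonneg (hs i) _)
  have e : ∀ i, (s i ^ (1 / b)) ^ b = s i := fun i => by
    rw [← Real.rpow_mul (hs i), one_div_mul_cancel hb0.ne', Real.rpow_one]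
  simp only [e] at key
  have h2 : (∑ i, w i) ^ (1 - b⁻¹) ≤ 1 :=
    Real.rpow_le_one (Finset.sum_nonneg fun i _ => hw i) h1
      (by rw [sub_nonneg]; exact inv_le_one_of_one_le₀ hb.le)
  have h0 : 0 ≤ ∑ i, w i * s i := Finset.sum_nonneg fun i _ => mul_nonneg (hw i) (hs i)
  have h3 : ∑ i, s i ^ (1 / b) * w i ≤ (∑ i, w i * s i) ^ b⁻¹ := by
    calc _ = ∑ i, w i * s i ^ (1 / b) := Finset.sum_congr rfl fun i _ => mul_comm _ _
      _ ≤ _ := key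
      _ ≤ _ := mul_le_of_le_one_left (Real.rpow_nonneg h0 _) h2
  calc _ ≤ ((∑ i, w i * s i) ^ b⁻¹) ^ b :=
        Real.rpow_le_rpow (Finset.sum_nonneg fun i _ =>
          mul_nonneg (Real.rpow_nonneg (hs i) _) (hw i)) h3 hb0.le
    _ = ∑ i, w i * s i := by rw [← Real.rpow_mul h0, inv_mul_cancel₀ hb0.ne', Real.rpow_one]
    _ = _ := Finset.sum_congr rfl fun i _ => mul_comm _ _

variable [DecidableEq ι]

theorem tr_eq_sum_diag {V : Matrix ι ι ℂ} (hV : V * Vᴴ = 1) (A : Matrix ι ι ℂ) :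
    tr A = ∑ j, ((Vᴴ * A * V) j j).re := by
  have : A.trace = (Vᴴ * A * V).trace := by
    rw [Matrix.trace_mul_comm, ← Matrix.mul_assoc, hV, Matrix.one_mul]
  rw [tr, this, Matrix.trace, Complex.re_sum]
  rfl

/-- The unitary matrix whose columns are an orthonormal eigenbasis of `A`. -/
noncomputable def eigU {A : Matrix ι ι ℂ} (hA : A.IsHermitian) : Matrix ι ι ℂ :=
  hA.eigenvectorUnitary

theorem eigU_mul_conjTranspose {A : Matrix ι ι ℂ} (hA : A.IsHermitian) : eigU hA * (eigU hA)ᴴ = 1 :=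
  Unitary.coe_mul_star_self hA.eigenvectorUnitary

theorem eigU_conjTranspose_mul_self {A : Matrix ι ι ℂ} (hA : A.IsHermitian) :
    (eigU hA)ᴴ * eigU hA = 1 :=
  Unitary.coe_star_mul_self hA.eigenvectorUnitary

theorem cfc_eq_eigU {A : Matrix ι ι ℂ} (hA : A.IsHermitian) (f : ℝ → ℝ) :
    cfc f A = eigU hA * diagonal (fun i => (f (hA.eigenvalues i) : ℂ)) * (eigU hA)ᴴ := by
  rw [hA.cfc_eq, Matrix.IsHermitian.cfc, Unitary.conjStarAlgAut_apply]
  rfl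

theorem cfc_self {A : Matrix ι ι ℂ} (hA : A.IsHermitian) : cfc (fun x : ℝ => x) A = A :=
  cfc_id' ℝ A (show IsSelfAdjoint A from hA)

theorem cfc_congr_eigenvalues {A : Matrix ι ι ℂ} (hA : A.IsHermitian) {f g : ℝ → ℝ}
    (h : ∀ i, f (hA.eigenvalues i) = g (hA.eigenvalues i)) : cfc f A = cfc g A := by
  simp only [cfc_eq_eigU hA, h]

theorem eigU_conjTranspose_mul {A : Matrix ι ι ℂ} (hA : A.IsHermitian) :
    (eigU hA)ᴴ * A = diagonal (fun i => (hA.eigenvalues i : ℂ)) * (eigU hA)ᴴ := by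
  have h := cfc_eq_eigU hA (fun x => x)
  rw [cfc_self hA] at h
  calc (eigU hA)ᴴ * A = (eigU hA)ᴴ *
        (eigU hA * diagonal (fun i => (hA.eigenvalues i : ℂ)) * (eigU hA)ᴴ) :=
        congrArg ((eigU hA)ᴴ * ·) h
    _ = _ := by simp only [← Matrix.mul_assoc, eigU_conjTranspose_mul_self, Matrix.one_mul]

theorem tr_cfc {A : Matrix ι ι ℂ} (hA : A.IsHermitian) (f : ℝ → ℝ) :
    tr (cfc f A) = ∑ i, f (hA.eigenvalues i) := by
  rw [cfc_eq_eigU hA, tr, Matrix.trace_mul_comm, ← Matrix.mul_assoc,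
    eigU_conjTranspose_mul_self, Matrix.one_mul, Matrix.trace_diagonal, Complex.re_sum]
  simp

theorem isHermitian_cfc (A : Matrix ι ι ℂ) (f : ℝ → ℝ) : (cfc f A).IsHermitian :=
  cfc_predicate f A

theorem continuousOn_spectrum {A : Matrix ι ι ℂ} (hA : A.IsHermitian) (f : ℝ → ℝ) :
    ContinuousOn f (spectrum ℝ A) := by
  rw [hA.spectrum_real_eq_range_eigenvalues]
  exact (Set.finite_range _).continuousOn f

/-- No continuity is needed: the spectrum is finite. -/
theorem cfc_mul_matrix {A : Matrix ι ι ℂ} (hA : A.IsHermitian) (f g : ℝ → ℝ) :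
    cfc f A * cfc g A = cfc (fun x => f x * g x) A := by
  rw [cfc_mul f g A (continuousOn_spectrum hA f) (continuousOn_spectrum hA g)]

theorem posSemidef_cfc {A : Matrix ι ι ℂ} (hA : A.IsHermitian) {f : ℝ → ℝ}
    (hf : ∀ i, 0 ≤ f (hA.eigenvalues i)) : (cfc f A).PosSemidef := by
  rw [cfc_eq_eigU hA]
  refine PosSemidef.mul_mul_conjTranspose_same (PosSemidef.diagonal fun i => ?_) _
  simpa using hf i

/-- In the columns `v` of any matrix `V`, the quadratic form of `f(A)` is the average of `f` over
the spectral distribution of `v`. -/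
theorem diag_cfc {A : Matrix ι ι ℂ} (hA : A.IsHermitian) (f : ℝ → ℝ) (V : Matrix ι ι ℂ) (j : ι) :
    ((Vᴴ * cfc f A * V) j j).re
      = ∑ l, f (hA.eigenvalues l) * ‖((eigU hA)ᴴ * V) l j‖ ^ 2 := by
  have : Vᴴ * cfc f A * V = ((eigU hA)ᴴ * V)ᴴ *
      (diagonal (fun i => (f (hA.eigenvalues i) : ℂ)) * ((eigU hA)ᴴ * V)) := by
    rw [cfc_eq_eigU hA]
    simp only [conjTranspose_mul, conjTranspose_conjTranspose, Matrix.mul_assoc]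
  rw [this, Matrix.mul_apply, Complex.re_sum]
  refine Finset.sum_congr rfl fun l _ => ?_
  rw [diagonal_mul, conjTranspose_apply]
  simp only [RCLike.star_def, Complex.sq_norm, Complex.normSq_apply, Complex.mul_re,
    Complex.conj_re, Complex.conj_im, Complex.mul_im, Complex.ofReal_re, Complex.ofReal_im]
  ring

theorem sum_norm_sq_eigU {A : Matrix ι ι ℂ} (hA : A.IsHermitian) (V : Matrix ι ι ℂ) (j : ι) :
    ∑ l, ‖((eigU hA)ᴴ * V) l j‖ ^ 2 = ((Vᴴ * V) j j).re := by
  rw [← diag_conjTranspose_mul_self, conjTranspose_mul, conjTranspose_conjTranspose,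
    Matrix.mul_assoc, ← Matrix.mul_assoc (eigU hA), eigU_mul_conjTranspose, Matrix.one_mul]

theorem diag_self {A : Matrix ι ι ℂ} (hA : A.IsHermitian) (V : Matrix ι ι ℂ) (j : ι) :
    ((Vᴴ * A * V) j j).re = ∑ l, hA.eigenvalues l * ‖((eigU hA)ᴴ * V) l j‖ ^ 2 := by
  rw [← diag_cfc hA (fun x => x), cfc_self hA]

theorem diag_eigU {A : Matrix ι ι ℂ} (hA : A.IsHermitian) (j : ι) :
    (((eigU hA)ᴴ * A * eigU hA) j j).re = hA.eigenvalues j := by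
  rw [eigU_conjTranspose_mul, Matrix.mul_assoc, eigU_conjTranspose_mul_self,
    Matrix.mul_one, diagonal_apply_eq, Complex.ofReal_re]

/-- A trace inequality `tr Z K ≤ tr f(Z) + tr g(K)` follows from the scalar one `x y ≤ f x + g y` on
the spectra, because the overlaps of the two eigenbases form a doubly stochastic matrix. -/
theorem tr_mul_le_of_forall {Z K : Matrix ι ι ℂ} (hZ : Z.IsHermitian) (hK : K.IsHermitian)
    (f g : ℝ → ℝ) (h : ∀ i j, hZ.eigenvalues i * hK.eigenvalues j
      ≤ f (hZ.eigenvalues i) + g (hK.eigenvalues j)) :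
    tr (Z * K) ≤ tr (cfc f Z) + tr (cfc g K) := by
  set w : ι → ι → ℝ := fun l k => ‖((eigU hK)ᴴ * eigU hZ) l k‖ ^ 2 with hw
  have hcol : ∀ k, ∑ l, w l k = 1 := fun k => by
    rw [hw]; simp only; rw [sum_norm_sq_eigU, eigU_conjTranspose_mul_self]; simp
  have hrow : ∀ l, ∑ k, w l k = 1 := fun l => by
    have := sum_norm_sq_eigU hZ (eigU hK) l
    rw [eigU_conjTranspose_mul_self] at this
    simp only [one_apply_eq, Complex.one_re] at this
    rw [← this]
    refine Finset.sum_congr rfl fun k _ => ?_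
    have e : ((eigU hK)ᴴ * eigU hZ) = ((eigU hZ)ᴴ * eigU hK)ᴴ := by simp
    rw [hw]; simp only; rw [e, conjTranspose_apply, norm_star]
  have e1 : tr (Z * K) = ∑ k, ∑ l, w l k * (hZ.eigenvalues k * hK.eigenvalues l) := by
    rw [tr_eq_sum_diag (eigU_mul_conjTranspose hZ)]
    refine Finset.sum_congr rfl fun k _ => ?_
    have : (eigU hZ)ᴴ * (Z * K) * eigU hZ =
        diagonal (fun i => (hZ.eigenvalues i : ℂ)) * ((eigU hZ)ᴴ * K * eigU hZ) := by
      simp only [← Matrix.mul_assoc, eigU_conjTranspose_mul]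
    rw [this, diagonal_mul, Complex.re_ofReal_mul]
    rw [diag_self hK, Finset.mul_sum]
    exact Finset.sum_congr rfl fun l _ => by rw [hw]; ring
  rw [e1, tr_cfc hZ, tr_cfc hK]
  calc _ ≤ ∑ k, ∑ l, w l k * (f (hZ.eigenvalues k) + g (hK.eigenvalues l)) := by
        gcongr with k _ l _
        exact h k l
    _ = _ := by
        simp only [mul_add, Finset.sum_add_distrib]
        congr 1
        · simp only [← Finset.sum_mul, hcol, one_mul]
        · rw [Finset.sum_comm]
          simp only [← Finset.sum_mul, hrow, one_mul]

/-- `M Mᴴ` and `Mᴴ M` have the same characteristic polynomial, hence the same eigenvalues. -/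
theorem tr_cfc_mul_comm (M : Matrix ι ι ℂ) (f : ℝ → ℝ) :
    tr (cfc f (M * Mᴴ)) = tr (cfc f (Mᴴ * M)) := by
  have h1 : (M * Mᴴ).IsHermitian := isHermitian_mul_conjTranspose_self M
  have h2 : (Mᴴ * M).IsHermitian := isHermitian_conjTranspose_mul_self M
  rw [tr_cfc h1, tr_cfc h2, (h1.eigenvalues_eq_eigenvalues_iff h2).2 (Matrix.charpoly_mul_comm _ _)]

/-! ### Data processing under a projective test -/

/-- Trace form of Jensen's inequality for the compression by a projection `B`:
`tr (B σ^(1/b) B)^b ≤ tr B σ`. -/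
theorem tr_mpow_compression_le {σ B : Matrix ι ι ℂ} (hσ : σ.PosSemidef) (hB : B.IsHermitian)
    (hBB : B * B = B) {b : ℝ} (hb : 1 < b) :
    tr (mpow (B * mpow σ (1 / b) * B) b) ≤ tr (B * σ) := by
  have hK : (B * mpow σ (1 / b) * B).IsHermitian := by
    have := isHermitian_conjTranspose_mul_mul B (isHermitian_cfc σ (fun x => x ^ (1 / b)))
    rwa [hB.eq] at this
  set V := eigU hK with hV
  have e2 : tr (B * σ) = ∑ j, (((B * V)ᴴ * σ * (B * V)) j j).re := by
    have : tr (B * σ) = tr (B * σ * B) := by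
      rw [tr_mul_comm (B * σ), ← Matrix.mul_assoc, hBB]
    rw [this, tr_eq_sum_diag (eigU_mul_conjTranspose hK)]
    simp only [conjTranspose_mul, hB.eq, Matrix.mul_assoc, hV]
  rw [mpow, tr_cfc hK, e2]
  refine Finset.sum_le_sum fun j _ => ?_
  have e3 : hK.eigenvalues j = ∑ l, hσ.1.eigenvalues l ^ (1 / b) *
      ‖((eigU hσ.1)ᴴ * (B * V)) l j‖ ^ 2 := by
    rw [← diag_cfc hσ.1 (fun x => x ^ (1 / b)), ← diag_eigU hK]
    simp only [conjTranspose_mul, hB.eq, Matrix.mul_assoc, mpow, hV]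
  have e4 : (((B * V)ᴴ * σ * (B * V)) j j).re = ∑ l, hσ.1.eigenvalues l *
      ‖((eigU hσ.1)ᴴ * (B * V)) l j‖ ^ 2 := by
    rw [diag_self hσ.1]
  rw [e3, e4]
  refine sum_mul_rpow_le hb _ _ (fun _ => sq_nonneg _) hσ.eigenvalues_nonneg ?_
  rw [sum_norm_sq_eigU]
  have h5 : (B * V)ᴴ * (B * V) = 1 - (V - B * V)ᴴ * (V - B * V) := by
    have h6 : Vᴴ * V = 1 := eigU_conjTranspose_mul_self hK
    have h7 : Vᴴ * B * (B * V) = Vᴴ * (B * V) := by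
      rw [Matrix.mul_assoc, ← Matrix.mul_assoc B, hBB]
    simp only [conjTranspose_sub, conjTranspose_mul, hB.eq, Matrix.sub_mul, Matrix.mul_sub, h6, h7,
      Matrix.mul_assoc Vᴴ B V]
    abel
  -- The columns of `B * V` have norm at most one, since `B` is a projection.
  rw [h5, Matrix.sub_apply, Complex.sub_re]
  have := re_diag_nonneg (posSemidef_conjTranspose_mul_self (V - B * V)) j
  simp only [one_apply_eq, Complex.one_re]
  linarith

/-- If `ker σ ⊆ ker ρ`, sandwiching `ρ` between copies of `σ^(-s)` and then of `σ^s` gives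
back `ρ`. -/
theorem mpow_sandwich {ρ σ : Matrix ι ι ℂ} (hρ : ρ.IsHermitian) (hσ : σ.PosSemidef)
    (h : SuppLE ρ σ) (s : ℝ) :
    mpow σ s * (mpow σ (-s) * ρ * mpow σ (-s)) * mpow σ s = ρ := by
  -- `p` is the projection onto the support of `σ`.
  set p := cfc (fun x : ℝ => x ^ s * x ^ (-s)) σ with hp
  have h1 : mpow σ s * mpow σ (-s) = p := cfc_mul_matrix hσ.1 _ _
  have h2 : mpow σ (-s) * mpow σ s = p := by
    rw [mpow, mpow, cfc_mul_matrix hσ.1, hp]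
    simp only [mul_comm]
  have hσp : σ * p = σ := by
    conv_lhs => rw [hp]
    conv_lhs => enter [1]; rw [← cfc_self hσ.1]
    rw [cfc_mul_matrix hσ.1]
    refine (cfc_congr_eigenvalues hσ.1 fun i => ?_).trans (cfc_self hσ.1)
    rcases (hσ.eigenvalues_nonneg i).eq_or_lt with h0 | h0
    · rw [← h0, zero_mul]
    · rw [← Real.rpow_add h0, add_neg_cancel, Real.rpow_zero, mul_one]
  have hρp : ρ * p = ρ := by
    have h0 : ρ * (p - 1) = 0 := by
      refine Matrix.ext_of_mulVec_single fun j => ?_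
      have : (p - 1) *ᵥ Pi.single j 1 ∈ LinearMap.ker σ.mulVecLin := by
        rw [LinearMap.mem_ker, mulVecLin_apply, mulVec_mulVec, Matrix.mul_sub, hσp, Matrix.mul_one,
          sub_self, zero_mulVec]
      have := h this
      rw [LinearMap.mem_ker, mulVecLin_apply, mulVec_mulVec] at this
      rw [this, zero_mulVec]
    rwa [Matrix.mul_sub, Matrix.mul_one, sub_eq_zero] at h0
  have hpρ : p * ρ = ρ := by
    have := congrArg conjTranspose hρp
    rwa [conjTranspose_mul, hρ.eq, (isHermitian_cfc σ _).eq] at this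
  calc _ = (mpow σ s * mpow σ (-s)) * ρ * (mpow σ (-s) * mpow σ s) := by
        simp only [Matrix.mul_assoc]
    _ = ρ := by rw [h1, h2, hpρ, hρp]

/-- The quantity `tr (σ^((1-α)/(2α)) ρ σ^((1-α)/(2α)))^α` whose logarithm is the sandwiched Rényi
divergence, up to normalization. -/
noncomputable def sandwichedTrace (α : ℝ) (ρ σ : Matrix ι ι ℂ) : ℝ :=
  tr (mpow (mpow σ ((1 - α) / (2 * α)) * ρ * mpow σ ((1 - α) / (2 * α))) α)

/-- A linearized data-processing inequality for the sandwiched Rényi divergence under the test `B`: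
Young's inequality `x y ≤ c x^α + d y^β` is lifted to the trace. -/
theorem tr_mul_le_sandwichedTrace {ρ σ B : Matrix ι ι ℂ} (hρ : ρ.PosSemidef) (hσ : σ.PosSemidef)
    (h : SuppLE ρ σ) (hB : B.IsHermitian) (hBB : B * B = B) {α c d : ℝ} (hα : 1 < α)
    (hd : 0 ≤ d) (hy : ∀ x y : ℝ, 0 ≤ x → 0 ≤ y → x * y ≤ c * x ^ α + d * y ^ (α / (α - 1))) :
    tr (B * ρ) ≤ c * sandwichedTrace α ρ σ + d * tr (B * σ) := by
  set β := α / (α - 1) with hβ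
  have hα1 : 0 < α - 1 := by linarith
  have hβ1 : 1 < β := by rw [hβ, lt_div_iff₀ hα1]; linarith
  set s := (α - 1) / (2 * α) with hs
  have hs' : (1 - α) / (2 * α) = -s := by rw [hs, ← neg_div, neg_sub]
  have hsβ : s + s = 1 / β := by rw [hs, hβ]; field_simp; ring
  have hs0 : 0 ≤ s := by rw [hs]; positivity
  set Z := mpow σ (-s) * ρ * mpow σ (-s) with hZdef
  set S := mpow σ s with hS
  have hSh : Sᴴ = S := (isHermitian_cfc σ _).eq
  have hNh : (mpow σ (-s))ᴴ = mpow σ (-s) := (isHermitian_cfc σ _).eq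
  have hZ : Z.PosSemidef := by
    have := hρ.mul_mul_conjTranspose_same (mpow σ (-s))
    rwa [hNh] at this
  have hSS : S * S = mpow σ (1 / β) := by
    rw [hS, mpow, cfc_mul_matrix hσ.1, mpow]
    refine cfc_congr_eigenvalues hσ.1 fun i => ?_
    rw [← hsβ, Real.rpow_add_of_nonneg (hσ.eigenvalues_nonneg i) hs0 hs0]
  set M := S * B with hM
  have hK : (M * Mᴴ).PosSemidef := posSemidef_self_mul_conjTranspose M
  have e1 : tr (B * ρ) = tr (Z * (M * Mᴴ)) := by
    have e : M * Mᴴ = S * B * S := by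
      rw [hM, conjTranspose_mul, hSh, hB.eq, Matrix.mul_assoc S B, ← Matrix.mul_assoc B, hBB,
        Matrix.mul_assoc]
    rw [e, ← mpow_sandwich hρ.1 hσ h s, ← hZdef, ← hS, tr_mul_comm]
    have : S * Z * S * B = S * (Z * (S * B)) := by simp only [Matrix.mul_assoc]
    rw [this, tr_mul_comm]
    simp only [Matrix.mul_assoc]
  have e2 := tr_mul_le_of_forall hZ.1 hK.1 (fun x => c * x ^ α) (fun y => d * y ^ β)
    (fun i j => hy _ _ (hZ.eigenvalues_nonneg i) (hK.eigenvalues_nonneg j))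
  have e3 : ∀ {A : Matrix ι ι ℂ} (hA : A.IsHermitian) (k t : ℝ),
      tr (cfc (fun x => k * x ^ t) A) = k * tr (mpow A t) := fun hA k t => by
    rw [mpow, tr_cfc hA, tr_cfc hA, Finset.mul_sum]
  have e4 : tr (mpow (M * Mᴴ) β) ≤ tr (B * σ) := by
    rw [mpow, tr_cfc_mul_comm]
    have : Mᴴ * M = B * mpow σ (1 / β) * B := by
      rw [hM, conjTranspose_mul, hSh, hB.eq, ← hSS]
      simp only [Matrix.mul_assoc]
    rw [this]
    exact tr_mpow_compression_le hσ hB hBB hβ1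
  rw [e3 hZ.1, e3 hK.1] at e2
  rw [e1, sandwichedTrace, hs']
  calc _ ≤ _ := e2
    _ ≤ _ := by gcongr

/-- Young's inequality for `t x` and `y / t`, with `t` chosen so that the coefficient of
`y ^ (α / (α - 1))` is proportional to `m`. -/
theorem mul_le_weighted_young {α m x y : ℝ} (hα : 1 < α) (hm : 0 < m) (hx : 0 ≤ x) (hy : 0 ≤ y) :
    x * y ≤ (m ^ (-(α - 1)) / α) * x ^ α + (m * (1 - 1 / α)) * y ^ (α / (α - 1)) := by
  have hα1 : 0 < α - 1 := by linarith
  have hα0 : 0 < α := by linarith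
  set t := m ^ (-((α - 1) / α)) with ht
  have ht0 : 0 < t := Real.rpow_pos_of_pos hm _
  have hpq : α.HolderConjugate (α / (α - 1)) := Real.HolderConjugate.conjExponent hα
  have := Real.young_inequality_of_nonneg (mul_nonneg ht0.le hx) (div_nonneg hy ht0.le) hpq
  have e0 : t * x * (y / t) = x * y := by field_simp
  have e1 : (t * x) ^ α = m ^ (-(α - 1)) * x ^ α := by
    rw [Real.mul_rpow ht0.le hx, ht, ← Real.rpow_mul hm.le]
    congr 2; field_simp
  have e2 : (y / t) ^ (α / (α - 1)) = m * y ^ (α / (α - 1)) := by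
    rw [Real.div_rpow hy ht0.le, ht, ← Real.rpow_mul hm.le]
    have : -((α - 1) / α) * (α / (α - 1)) = -1 := by field_simp
    rw [this, Real.rpow_neg_one, div_inv_eq_mul, mul_comm]
  rw [e0, e1, e2] at this
  refine this.trans_eq ?_
  field_simp

/-- Were the sandwiched trace not positive, the trivial test `1` would give `tr ρ ≤ m tr σ` for all
`m > 0`. -/
theorem sandwichedTrace_pos {ρ σ : Matrix ι ι ℂ} (hρ : ρ.PosSemidef) (hσ : σ.PosSemidef)
    (h : SuppLE ρ σ) {α : ℝ} (hα : 1 < α) (hr : 0 < tr ρ) : 0 < sandwichedTrace α ρ σ := by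
  by_contra hQ
  rw [not_lt] at hQ
  have hσ0 : 0 ≤ tr σ := tr_nonneg hσ
  set m := tr ρ / (tr σ + 1) with hm
  have hm0 : 0 < m := by positivity
  have h1 : 1 / α ≤ 1 := by rw [div_le_one (by linarith)]; exact hα.le
  have h2 : 0 < 1 / α := by positivity
  have key := tr_mul_le_sandwichedTrace hρ hσ h isHermitian_one (Matrix.one_mul 1) hα
    (mul_nonneg hm0.le (sub_nonneg.2 h1)) (fun x y hx hy => mul_le_weighted_young hα hm0 hx hy)
  rw [Matrix.one_mul, Matrix.one_mul] at key
  have h3 : m ^ (-(α - 1)) / α * sandwichedTrace α ρ σ ≤ 0 :=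
    mul_nonpos_of_nonneg_of_nonpos (by positivity) hQ
  have h4 : m * (1 - 1 / α) * tr σ ≤ m * tr σ := by
    have := mul_nonneg hm0.le hσ0
    nlinarith
  have h5 : m * (tr σ + 1) = tr ρ := by rw [hm]; field_simp
  linarith

/-- The tail bound: if a test `B` has probability under `ρ` at least `m` times that under `σ`,
then it has small probability under `ρ`. -/
theorem tr_mul_le_of_le {ρ σ B : Matrix ι ι ℂ} (hρ : ρ.PosSemidef) (hσ : σ.PosSemidef)
    (h : SuppLE ρ σ) (hB : B.IsHermitian) (hBB : B * B = B) {α m : ℝ} (hα : 1 < α) (hm : 0 < m)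
    (hle : m * tr (B * σ) ≤ tr (B * ρ)) :
    tr (B * ρ) ≤ m ^ (-(α - 1)) * sandwichedTrace α ρ σ := by
  have hα0 : 0 < α := by linarith
  have h1 : 1 / α ≤ 1 := by rw [div_le_one (by linarith)]; exact hα.le
  have key := tr_mul_le_sandwichedTrace hρ hσ h hB hBB hα
    (mul_nonneg hm.le (sub_nonneg.2 h1)) (fun x y hx hy => mul_le_weighted_young hα hm hx hy)
  have h2 := mul_le_mul_of_nonneg_left hle (sub_nonneg.2 h1)
  have h3 : 1 / α * tr (B * ρ) ≤ 1 / α * (m ^ (-(α - 1)) * sandwichedTrace α ρ σ) := by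
    have e : m ^ (-(α - 1)) / α * sandwichedTrace α ρ σ
      = 1 / α * (m ^ (-(α - 1)) * sandwichedTrace α ρ σ) := by ring
    rw [e] at key
    linarith
  exact le_of_mul_le_mul_left h3 (by positivity)

end

/-! ### Couplings, fidelity and trace distance -/

section

theorem posDef_add_smul_one {ι : Type*} [DecidableEq ι] {A : Matrix ι ι ℂ} (hA : A.PosSemidef)
    {δ : ℝ} (hδ : 0 < δ) :
    (A + δ • (1 : Matrix ι ι ℂ)).PosDef :=
  PosDef.posSemidef_add hA (PosDef.one.smul hδ)

section Coupling
variable {ι : Type*}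

/-- `X` couples `ρ` and `τ`: the block matrix with diagonal `ρ`, `τ` and off-diagonal `X`, `Xᴴ` is
positive semidefinite. This is the constraint in the semidefinite program for the fidelity, and a
convex condition on `(ρ, τ, X)`. -/
def IsCoupling (ρ τ X : Matrix ι ι ℂ) : Prop :=
  (fromBlocks ρ X Xᴴ τ).PosSemidef

theorem IsCoupling.posSemidef_right {ρ τ X : Matrix ι ι ℂ} (h : IsCoupling ρ τ X) :
    τ.PosSemidef := by
  have := h.submatrix (Sum.inr : ι → ι ⊕ ι)
  rwa [show (fromBlocks ρ X Xᴴ τ).submatrix Sum.inr Sum.inr = τ from rfl] at this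

theorem IsCoupling.combination [Fintype ι] [DecidableEq ι] {ρ τ X : Matrix ι ι ℂ}
    (h : IsCoupling ρ τ X) (a b : ℝ) :
    (a ^ 2 • ρ + (a * b) • (X + Xᴴ) + b ^ 2 • τ).PosSemidef := by
  have := PosSemidef.conjTranspose_mul_mul_same h
    (fromRows (a • (1 : Matrix ι ι ℂ)) (b • (1 : Matrix ι ι ℂ)))
  convert this using 1
  rw [conjTranspose_fromRows_eq_fromCols_conjTranspose, fromCols_mul_fromBlocks,
    fromCols_mul_fromRows]
  simp only [conjTranspose_smul, conjTranspose_one, Matrix.smul_mul, Matrix.mul_smul,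
    Matrix.one_mul, Matrix.mul_one, star_trivial]
  module

/-- The Gram-type block matrix of two maps `A`, `B` applied to `ρ`. -/
theorem posSemidef_fromBlocks_conj [Fintype ι] {ρ : Matrix ι ι ℂ} (hρ : ρ.PosSemidef)
    (A B : Matrix ι ι ℂ) :
    (fromBlocks (A * ρ * Aᴴ) (A * ρ * Bᴴ) (B * ρ * Aᴴ) (B * ρ * Bᴴ)).PosSemidef := by
  have := hρ.mul_mul_conjTranspose_same (fromRows A B)
  rwa [conjTranspose_fromRows_eq_fromCols_conjTranspose, fromRows_mul, fromRows_mul_fromCols]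
    at this

end Coupling

variable {ι : Type*} [Fintype ι] [DecidableEq ι]

theorem traceNorm_eq_sum (Y : Matrix ι ι ℂ) :
    traceNorm Y = ∑ i, Real.sqrt
      ((isHermitian_conjTranspose_mul_self Y).eigenvalues i) :=
  tr_cfc _ _

theorem traceNorm_eq_sum_abs {H : Matrix ι ι ℂ} (hH : H.IsHermitian) :
    traceNorm H = ∑ i, |hH.eigenvalues i| := by
  have : Hᴴ * H = cfc (fun x : ℝ => x * x) H := by
    rw [hH.eq, ← cfc_mul_matrix hH, cfc_self hH]
  rw [traceNorm, msqrt, this, ← cfc_comp' Real.sqrt (fun x : ℝ => x * x) H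
    Real.continuous_sqrt.continuousOn (continuousOn_spectrum hH _)
    (show IsSelfAdjoint H from hH), tr_cfc hH]
  simp only [Real.sqrt_mul_self_eq_abs]

/-- A contraction `K` pairs with `Y` at most to the sum of the norms of `Y` on an orthonormal
basis. -/
theorem tr_contraction_mul_le {K Y U : Matrix ι ι ℂ} (hK : (1 - Kᴴ * K).PosSemidef)
    (hU : U * Uᴴ = 1) :
    tr (Kᴴ * Y) ≤ ∑ i, Real.sqrt ((Uᴴ * (Yᴴ * Y) * U) i i).re := by
  have hU' : Uᴴ * U = 1 := mul_eq_one_comm.1 hU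
  rw [tr_eq_sum_diag hU]
  refine Finset.sum_le_sum fun i _ => ?_
  have e1 : Uᴴ * (Kᴴ * Y) * U = (K * U)ᴴ * (Y * U) := by
    simp only [conjTranspose_mul, Matrix.mul_assoc]
  have e2 : Uᴴ * (Yᴴ * Y) * U = (Y * U)ᴴ * (Y * U) := by
    simp only [conjTranspose_mul, Matrix.mul_assoc]
  have hk : ∑ l, ‖(K * U) l i‖ ^ 2 ≤ 1 := by
    have h1 := re_diag_nonneg (hK.conjTranspose_mul_mul_same U) i
    have e3 : Uᴴ * (1 - Kᴴ * K) * U = 1 - (K * U)ᴴ * (K * U) := by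
      simp only [Matrix.mul_sub, Matrix.sub_mul, Matrix.mul_one, hU', conjTranspose_mul,
        Matrix.mul_assoc]
    rw [e3, Matrix.sub_apply, Complex.sub_re, diag_conjTranspose_mul_self, one_apply_eq,
      Complex.one_re] at h1
    linarith
  rw [e1, e2, diag_conjTranspose_mul_self, Matrix.mul_apply, Complex.re_sum]
  calc ∑ l, ((K * U)ᴴ i l * (Y * U) l i).re
      ≤ ∑ l, ‖(K * U) l i‖ * ‖(Y * U) l i‖ := by
        refine Finset.sum_le_sum fun l _ => (Complex.re_le_norm _).trans_eq ?_
        rw [norm_mul, conjTranspose_apply, norm_star]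
    _ ≤ Real.sqrt (∑ l, ‖(K * U) l i‖ ^ 2) * Real.sqrt (∑ l, ‖(Y * U) l i‖ ^ 2) :=
        Real.sum_mul_le_sqrt_mul_sqrt _ _ _
    _ ≤ 1 * Real.sqrt (∑ l, ‖(Y * U) l i‖ ^ 2) := by
        gcongr
        exact Real.sqrt_le_one.2 hk
    _ = _ := one_mul _

theorem posSemidef_msqrt {A : Matrix ι ι ℂ} (hA : A.PosSemidef) : (msqrt A).PosSemidef :=
  posSemidef_cfc hA.1 fun _ => Real.sqrt_nonneg _

theorem msqrt_mul_self {A : Matrix ι ι ℂ} (hA : A.PosSemidef) : msqrt A * msqrt A = A := by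
  rw [msqrt, cfc_mul_matrix hA.1]
  refine (cfc_congr_eigenvalues hA.1 fun i => ?_).trans (cfc_self hA.1)
  exact Real.mul_self_sqrt (hA.eigenvalues_nonneg i)

/-- The regularization `√A + δ` has a square dominating `A`. -/
theorem le_sq_msqrt_add {A : Matrix ι ι ℂ} (hA : A.PosSemidef) {δ : ℝ} (hδ : 0 < δ) :
    ((msqrt A + δ • (1 : Matrix ι ι ℂ)) * (msqrt A + δ • (1 : Matrix ι ι ℂ)) - A).PosSemidef := by
  have : (msqrt A + δ • (1 : Matrix ι ι ℂ)) * (msqrt A + δ • (1 : Matrix ι ι ℂ)) - A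
      = (2 * δ) • msqrt A + (δ ^ 2) • (1 : Matrix ι ι ℂ) := by
    simp only [Matrix.add_mul, Matrix.mul_add, msqrt_mul_self hA, Matrix.smul_mul, Matrix.mul_smul,
      Matrix.one_mul, Matrix.mul_one]
    module
  rw [this]
  exact ((posSemidef_msqrt hA).smul (by positivity)).add (PosSemidef.one.smul (by positivity))

/-- The square root of the fidelity bounds the trace of every coupling. For singular `ρ` and `τ` the
bound is first proved for `√ρ + δ` and `√τ + δ`; the norms are taken on one orthonormal basis,
that of `δ = 0`, so that the limit `δ → 0` only involves a continuous expression. -/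
theorem IsCoupling.tr_le_traceNorm {ρ τ X : Matrix ι ι ℂ} (hρ : ρ.PosSemidef) (hτ : τ.PosSemidef)
    (h : IsCoupling ρ τ X) : tr X ≤ traceNorm (msqrt ρ * msqrt τ) := by
  set Y : ℝ → Matrix ι ι ℂ := fun δ =>
    (msqrt ρ + δ • (1 : Matrix ι ι ℂ)) * (msqrt τ + δ • (1 : Matrix ι ι ℂ)) with hY
  have hY0 : Y 0 = msqrt ρ * msqrt τ := by simp [hY]
  set U := eigU (isHermitian_conjTranspose_mul_self (Y 0)) with hU
  set g : ℝ → ℝ := fun δ => ∑ i, Real.sqrt ((Uᴴ * ((Y δ)ᴴ * Y δ) * U) i i).re with hg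
  have hg0 : g 0 = traceNorm (msqrt ρ * msqrt τ) := by
    rw [← hY0, traceNorm_eq_sum, hg]
    exact Finset.sum_congr rfl fun i _ => by
      rw [hU, diag_eigU]
  have hgc : Continuous g := by
    have hYc : Continuous Y := by fun_prop
    have hYc' : Continuous fun δ => (Y δ)ᴴ := hYc.matrix_conjTranspose
    refine continuous_finsetSum _ fun i _ => Real.continuous_sqrt.comp
      (Complex.continuous_re.comp ?_)
    have : Continuous fun δ => Uᴴ * ((Y δ)ᴴ * Y δ) * U := by fun_prop
    exact this.matrix_elem i i
  have hlim : Filter.Tendsto g (nhdsWithin 0 (Set.Ioi 0)) (nhds (g 0)) :=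
    hgc.continuousAt.tendsto.mono_left nhdsWithin_le_nhds
  rw [← hg0]
  refine ge_of_tendsto hlim (Filter.eventually_of_mem self_mem_nhdsWithin fun δ hδ => ?_)
  have hδ : 0 < δ := hδ
  set P := msqrt ρ + δ • (1 : Matrix ι ι ℂ) with hP
  set Q := msqrt τ + δ • (1 : Matrix ι ι ℂ) with hQ
  have hPd : P.PosDef := posDef_add_smul_one (posSemidef_msqrt hρ) hδ
  have hQd : Q.PosDef := posDef_add_smul_one (posSemidef_msqrt hτ) hδ
  have hPu : IsUnit P.det := (isUnit_iff_isUnit_det P).1 hPd.isUnit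
  have hQu : IsUnit Q.det := (isUnit_iff_isUnit_det Q).1 hQd.isUnit
  have hPi : (P⁻¹)ᴴ = P⁻¹ := hPd.1.inv.eq
  have hQi : (Q⁻¹)ᴴ = Q⁻¹ := hQd.1.inv.eq
  -- Enlarging the diagonal blocks to `P * P` and `Q * Q` keeps the block matrix positive, and the
  -- Schur complement then exhibits `K = P⁻¹ X Q⁻¹` as a contraction.
  have hblock : (fromBlocks (P * P) X Xᴴ (Q * Q)).PosSemidef := by
    have h1 : (fromBlocks (P * P - ρ) 0 0 (Q * Q - τ)).PosSemidef := by
      have := (posSemidef_fromBlocks_conj (le_sq_msqrt_add hρ hδ) 1 0).add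
        (posSemidef_fromBlocks_conj (le_sq_msqrt_add hτ hδ) 0 1)
      simpa [fromBlocks_add] using this
    have := PosSemidef.add h h1
    rwa [fromBlocks_add, add_sub_cancel, add_sub_cancel, add_zero, add_zero] at this
  have hPP : (P * P).PosDef := by
    have := PosDef.conjTranspose_mul_self P (mulVec_injective_of_isUnit hPd.isUnit)
    rwa [hPd.1.eq] at this
  have : Invertible (P * P) := hPP.isUnit.invertible
  have hschur := (PosDef.fromBlocks₁₁ X (Q * Q) hPP).1 hblock
  set K := P⁻¹ * X * Q⁻¹ with hKdef
  have hK : (1 - Kᴴ * K).PosSemidef := by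
    have := hschur.conjTranspose_mul_mul_same Q⁻¹
    suffices e : 1 - Kᴴ * K = (Q⁻¹)ᴴ * (Q * Q - Xᴴ * (P * P)⁻¹ * X) * Q⁻¹ by rwa [e]
    rw [hQi, Matrix.mul_sub, Matrix.sub_mul, ← Matrix.mul_assoc Q⁻¹ Q Q, nonsing_inv_mul _ hQu,
      Matrix.one_mul, mul_nonsing_inv _ hQu, Matrix.mul_inv_rev, hKdef]
    simp only [conjTranspose_mul, hPi, hQi, Matrix.mul_assoc]
  have hX : P * K * Q = X := by
    rw [hKdef, Matrix.mul_assoc, Matrix.mul_assoc, nonsing_inv_mul _ hQu, Matrix.mul_one,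
      ← Matrix.mul_assoc, mul_nonsing_inv _ hPu, Matrix.one_mul]
  have e : tr X = tr (Kᴴ * Y δ) := by
    rw [← tr_conjTranspose, ← hX, conjTranspose_mul, conjTranspose_mul, hPd.1.eq, hQd.1.eq,
      tr_mul_comm, Matrix.mul_assoc]
  rw [e]
  exact tr_contraction_mul_le hK (eigU_mul_conjTranspose _)

/-- The Fuchs-van de Graaf bound, for normalized states with a coupling. -/
theorem IsCoupling.traceDist_le {ρ τ X : Matrix ι ι ℂ} (h : IsCoupling ρ τ X)
    (hρ : IsState ρ) (hτ : IsState τ) : traceDist ρ τ ≤ Real.sqrt (1 - tr X ^ 2) := by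
  have hH : (ρ - τ).IsHermitian := hρ.1.1.sub hτ.1.1
  set V := eigU hH with hV
  have hp := h.combination 1 1
  have hm := h.combination 1 (-1)
  set Ap := (1 : ℝ) ^ 2 • ρ + ((1 : ℝ) * 1) • (X + Xᴴ) + (1 : ℝ) ^ 2 • τ with hAp
  set Am := (1 : ℝ) ^ 2 • ρ + ((1 : ℝ) * (-1)) • (X + Xᴴ) + (-1 : ℝ) ^ 2 • τ with hAm
  set a : ι → ℝ := fun i => ((Vᴴ * Ap * V) i i).re with ha
  set b : ι → ℝ := fun i => ((Vᴴ * Am * V) i i).re with hb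
  have ha0 : ∀ i, 0 ≤ a i := fun i => re_diag_nonneg (hp.conjTranspose_mul_mul_same V) i
  have hb0 : ∀ i, 0 ≤ b i := fun i => re_diag_nonneg (hm.conjTranspose_mul_mul_same V) i
  -- Cauchy-Schwarz for the positive form of the block matrix, on `(v, v)` and `(v, -v)`.
  have hcs : ∀ i, |hH.eigenvalues i| ≤ Real.sqrt (a i) * Real.sqrt (b i) := fun i => by
    rw [← Real.sqrt_mul (ha0 i)]
    refine Real.abs_le_sqrt ?_
    have hquad : ∀ s : ℝ, 0 ≤ b i * (s * s) + 2 * hH.eigenvalues i * s + a i := fun s => by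
      have h1 := re_diag_nonneg ((h.combination (1 + s) (1 - s)).conjTranspose_mul_mul_same V) i
      have e : (1 + s) ^ 2 • ρ + ((1 + s) * (1 - s)) • (X + Xᴴ) + (1 - s) ^ 2 • τ
          = (s * s) • Am + (2 * s) • (ρ - τ) + Ap := by
        rw [hAp, hAm]; module
      rw [e] at h1
      simp only [Matrix.mul_add, Matrix.add_mul, Matrix.mul_smul, Matrix.smul_mul, Matrix.add_apply,
        Matrix.smul_apply, Complex.add_re, Complex.smul_re, smul_eq_mul] at h1
      have h2 := diag_eigU hH i
      simp only [ha, hb]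
      rw [← h2]
      linarith
    have := discrim_le_zero hquad
    rw [discrim] at this
    nlinarith
  have hsa : ∑ i, a i = 2 + 2 * tr X := by
    rw [← tr_eq_sum_diag (eigU_mul_conjTranspose hH), hAp]
    simp only [tr_add, tr_smul, tr_conjTranspose, hρ.2, hτ.2]
    ring
  have hsb : ∑ i, b i = 2 - 2 * tr X := by
    rw [← tr_eq_sum_diag (eigU_mul_conjTranspose hH), hAm]
    simp only [tr_add, tr_smul, tr_conjTranspose, hρ.2, hτ.2]
    ring
  have hsa0 : 0 ≤ ∑ i, a i := Finset.sum_nonneg fun i _ => ha0 i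
  rw [traceDist, traceNorm_eq_sum_abs hH]
  calc 1 / 2 * ∑ i, |hH.eigenvalues i|
      ≤ 1 / 2 * ∑ i, Real.sqrt (a i) * Real.sqrt (b i) := by
        gcongr with i _
        exact hcs i
    _ ≤ 1 / 2 * (Real.sqrt (∑ i, a i) * Real.sqrt (∑ i, b i)) := by
        gcongr
        exact Real.sum_sqrt_mul_sqrt_le _ ha0 hb0
    _ = Real.sqrt (1 - tr X ^ 2) := by
        rw [← Real.sqrt_mul hsa0, hsa, hsb,
          show (2 + 2 * tr X) * (2 - 2 * tr X) = 2 ^ 2 * (1 - tr X ^ 2) by ring,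
          Real.sqrt_mul (by norm_num), Real.sqrt_sq (by norm_num)]
        ring

end

/-! ### Minimax over a compact convex set of operators -/

section

variable {ι : Type*} [Fintype ι]

theorem isClosed_posSemidef : IsClosed {A : Matrix ι ι ℂ | A.PosSemidef} := by
  have : {A : Matrix ι ι ℂ | A.PosSemidef}
      = {A | Aᴴ = A} ∩ ⋂ x : ι → ℂ, {A | 0 ≤ star x ⬝ᵥ (A *ᵥ x)} := by
    ext A
    simp only [Set.mem_inter_iff, Set.mem_iInter, Set.mem_ofPred_eq,
      posSemidef_iff_dotProduct_mulVec, IsHermitian]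
  rw [this]
  refine IsClosed.inter (isClosed_eq (by fun_prop) continuous_id) (isClosed_iInter fun x => ?_)
  exact isClosed_le continuous_const (by fun_prop)

/-- Every real-linear functional on matrices is of the form `X ↦ Re tr (W X)`. -/
theorem exists_tr_mul_eq [DecidableEq ι] (f : Matrix ι ι ℂ →ₗ[ℝ] ℝ) :
    ∃ W : Matrix ι ι ℂ, ∀ X, tr (W * X) = f X := by
  refine ⟨Matrix.of fun j i => (f (single i j 1) : ℂ) - Complex.I * f (single i j Complex.I),
    fun X => ?_⟩
  have hX : f X = ∑ i, ∑ j, f (single i j (X i j)) := by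
    conv_lhs => rw [matrix_eq_sum_single X]
    simp only [map_sum]
  have hs : ∀ (i j : ι) (z : ℂ), f (single i j z)
      = z.re * f (single i j 1) + z.im * f (single i j Complex.I) := fun i j z => by
    have : single i j z = z.re • single i j (1 : ℂ) + z.im • single i j Complex.I := by
      simp only [smul_single, ← single_add, Complex.real_smul, mul_one, Complex.re_add_im]
    rw [this, map_add, map_smul, map_smul, smul_eq_mul, smul_eq_mul]
  rw [hX, tr, Matrix.trace, Complex.re_sum, Finset.sum_comm]
  refine Finset.sum_congr rfl fun j _ => ?_
  rw [diag_apply, Matrix.mul_apply, Complex.re_sum]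
  refine Finset.sum_congr rfl fun i _ => ?_
  rw [hs]
  simp
  ring

theorem tr_mul_vecMulVec (W : Matrix ι ι ℂ) (x : ι → ℂ) :
    tr (W * vecMulVec x (star x)) = (star x ⬝ᵥ (W *ᵥ x)).re := by
  rw [mul_vecMulVec, tr, trace_vecMulVec, dotProduct_comm]

/-- A minimax principle: if for every test `W ≥ 0` some element of the compact convex set `C` is
below `T` on `W`, then some element of `C` is below `T` in the Löwner order. -/
theorem exists_le_of_forall_tr_mul_le [DecidableEq ι] {C : Set (Matrix ι ι ℂ)} {T : Matrix ι ι ℂ}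
    (hC : Convex ℝ C) (hCc : IsCompact C) (hCh : ∀ τ ∈ C, τ.IsHermitian) (hT : T.IsHermitian)
    (h : ∀ W : Matrix ι ι ℂ, W.PosSemidef → ∃ τ ∈ C, tr (W * τ) ≤ tr (W * T)) :
    ∃ τ ∈ C, (T - τ).PosSemidef := by
  by_contra hne
  have hlc : LocallyConvexSpace ℝ (Matrix ι ι ℂ) :=
    inferInstanceAs (LocallyConvexSpace ℝ (ι → ι → ℂ))
  set t : Set (Matrix ι ι ℂ) := {A | (T - A).PosSemidef} with ht
  have htc : Convex ℝ t := by
    intro A hA B hB a b ha hb hab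
    have : T - (a • A + b • B) = a • (T - A) + b • (T - B) := by
      have : T = (a + b) • T := by rw [hab, one_smul]
      conv_lhs => rw [this]
      module
    rw [ht, Set.mem_ofPred_eq, this]
    exact (PosSemidef.smul hA ha).add (PosSemidef.smul hB hb)
  have htcl : IsClosed t := isClosed_posSemidef.preimage (continuous_const.sub continuous_id)
  have hdisj : Disjoint C t := Set.disjoint_left.2 fun τ h1 h2 => hne ⟨τ, h1, h2⟩
  obtain ⟨f, u, v, hfC, huv, hft⟩ := geometric_hahn_banach_compact_closed hC hCc htc htcl hdisj
  obtain ⟨W₀, hW₀⟩ := exists_tr_mul_eq (f : Matrix ι ι ℂ →ₗ[ℝ] ℝ)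
  set W := (-(1 / 2 : ℝ)) • (W₀ + W₀ᴴ) with hW
  have hWf : ∀ X : Matrix ι ι ℂ, X.IsHermitian → tr (W * X) = - f X := fun X hX => by
    have e : tr (W₀ᴴ * X) = tr (W₀ * X) := by
      rw [← tr_conjTranspose, conjTranspose_mul, conjTranspose_conjTranspose, hX.eq, tr_mul_comm]
    have e2 : tr (W₀ * X) = f X := hW₀ X
    rw [hW, Matrix.smul_mul, tr_smul, Matrix.add_mul, tr_add, e, e2]
    ring
  have hWh : W.IsHermitian := by
    rw [IsHermitian, hW, conjTranspose_smul, conjTranspose_add, conjTranspose_conjTranspose,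
      star_trivial, add_comm]
  have hWp : W.PosSemidef := by
    refine PosSemidef.of_dotProduct_mulVec_nonneg hWh fun x => ?_
    have hx := posSemidef_vecMulVec_self_star x
    have h1 : (star x ⬝ᵥ (W *ᵥ x)).im = 0 := hWh.im_star_dotProduct_mulVec_self x
    have h2 := tr_mul_vecMulVec W x
    rw [hWf _ hx.1] at h2
    refine Complex.le_def.2 ⟨?_, h1.symm⟩
    rw [← h2, Complex.zero_re]
    -- `f` is bounded below on the ray of all `T - n x xᴴ` with `n ≥ 0`.
    by_contra hneg
    push Not at hneg
    set q := f (vecMulVec x (star x)) with hq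
    have hq0 : 0 < q := by linarith
    have hn : ∀ n : ℝ, 0 ≤ n → v < f T - n * q := fun n hn => by
      have := hft (T - n • vecMulVec x (star x)) (by
        rw [ht, Set.mem_ofPred_eq, sub_sub_cancel]; exact hx.smul hn)
      rwa [map_sub, map_smul, smul_eq_mul] at this
    have h0 := hn 0 le_rfl
    have h3 := hn ((f T - v) / q) (div_nonneg (by linarith) hq0.le)
    rw [div_mul_cancel₀ _ hq0.ne'] at h3
    linarith
  obtain ⟨τ, hτC, hτ⟩ := h W hWp
  rw [hWf _ (hCh τ hτC), hWf _ hT] at hτ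
  have h1 := hfC τ hτC
  have h2 := hft T (by rw [ht, Set.mem_ofPred_eq, sub_self]; exact PosSemidef.zero)
  linarith

/-- By Cauchy-Schwarz for the Gram matrix `A = √A √A`. -/
theorem norm_apply_le_tr [DecidableEq ι] {A : Matrix ι ι ℂ} (hA : A.PosSemidef) (i j : ι) :
    ‖A i j‖ ≤ tr A := by
  set S := msqrt A with hS
  have hA' : A = Sᴴ * S := by rw [(posSemidef_msqrt hA).1.eq, msqrt_mul_self hA]
  have hd : ∀ k, ∑ l, ‖S l k‖ ^ 2 ≤ tr A := fun k => by
    rw [← diag_conjTranspose_mul_self, ← hA', tr, Matrix.trace, Complex.re_sum]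
    exact Finset.single_le_sum (f := fun k => (A k k).re) (fun k _ => re_diag_nonneg hA k)
      (Finset.mem_univ k)
  calc ‖A i j‖ = ‖∑ l, Sᴴ i l * S l j‖ := by rw [← Matrix.mul_apply, ← hA']
    _ ≤ ∑ l, ‖Sᴴ i l * S l j‖ := norm_sum_le _ _
    _ ≤ ∑ l, 1 / 2 * (‖S l i‖ ^ 2 + ‖S l j‖ ^ 2) := by
        refine Finset.sum_le_sum fun l _ => ?_
        rw [norm_mul, conjTranspose_apply, norm_star]
        nlinarith [sq_nonneg (‖S l i‖ - ‖S l j‖)]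
    _ ≤ tr A := by
        rw [← Finset.mul_sum, Finset.sum_add_distrib]
        linarith [hd i, hd j]

theorem isCompact_posSemidef_tr [DecidableEq ι] (r : ℝ) :
    IsCompact {A : Matrix ι ι ℂ | A.PosSemidef ∧ tr A = r} := by
  have hK : IsCompact {A : Matrix ι ι ℂ | ∀ i j, A i j ∈ Metric.closedBall (0 : ℂ) r} := by
    have : IsCompact {A : ι → ι → ℂ | ∀ i j, A i j ∈ Metric.closedBall (0 : ℂ) r} := by
      have := isCompact_univ_pi
        (s := fun _ : ι => Set.univ.pi fun _ : ι => Metric.closedBall (0 : ℂ) r)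
        fun _ => isCompact_univ_pi fun _ => isCompact_closedBall _ _
      simpa only [Set.pi, Set.mem_univ, true_implies, Set.mem_ofPred_eq] using this
    exact this
  refine hK.of_isClosed_subset (isClosed_posSemidef.inter (isClosed_eq ?_ continuous_const)) ?_
  · exact Complex.continuous_re.comp (continuous_id.matrix_trace)
  · rintro A ⟨hA, rfl⟩ i j
    rw [mem_closedBall_zero_iff]
    exact norm_apply_le_tr hA i j

/-- The operators of trace `r` that have a coupling with `ρ` of real trace at least `c`: a fidelity
ball of fixed trace. -/
def couplingBall (ρ : Matrix ι ι ℂ) (r c : ℝ) : Set (Matrix ι ι ℂ) :=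
  {τ | tr τ = r ∧ ∃ X, IsCoupling ρ τ X ∧ c ≤ tr X}

theorem convex_couplingBall (ρ : Matrix ι ι ℂ) (r c : ℝ) : Convex ℝ (couplingBall ρ r c) := by
  rintro τ ⟨hτ, X, hX, hXc⟩ τ' ⟨hτ', X', hX', hXc'⟩ a b ha hb hab
  refine ⟨?_, a • X + b • X', ?_, ?_⟩
  · rw [tr_add, tr_smul, tr_smul, hτ, hτ', ← add_mul, hab, one_mul]
  · have := (PosSemidef.smul hX ha).add (PosSemidef.smul hX' hb)
    rw [fromBlocks_smul, fromBlocks_smul, fromBlocks_add, ← add_smul, hab, one_smul] at this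
    rwa [IsCoupling, conjTranspose_add, conjTranspose_smul, conjTranspose_smul, star_trivial,
      star_trivial]
  · rw [tr_add, tr_smul, tr_smul]
    calc c = a * c + b * c := by rw [← add_mul, hab, one_mul]
      _ ≤ _ := by gcongr

theorem isCompact_couplingBall [DecidableEq ι] (ρ : Matrix ι ι ℂ) (r c : ℝ) :
    IsCompact (couplingBall ρ r c) := by
  set S : Set (Matrix (ι ⊕ ι) (ι ⊕ ι) ℂ) := {M | M.PosSemidef ∧ tr M = tr ρ + r} ∩
    {M | M.toBlocks₁₁ = ρ ∧ c ≤ tr M.toBlocks₁₂} with hS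
  have hcl : IsClosed {M : Matrix (ι ⊕ ι) (ι ⊕ ι) ℂ | M.toBlocks₁₁ = ρ ∧ c ≤ tr M.toBlocks₁₂} := by
    have h1 : Continuous fun M : Matrix (ι ⊕ ι) (ι ⊕ ι) ℂ => M.toBlocks₁₁ :=
      continuous_matrix fun i j => continuous_id.matrix_elem _ _
    have h2 : Continuous fun M : Matrix (ι ⊕ ι) (ι ⊕ ι) ℂ => M.toBlocks₁₂ :=
      continuous_matrix fun i j => continuous_id.matrix_elem _ _
    exact (isClosed_eq h1 continuous_const).inter
      (isClosed_le continuous_const (Complex.continuous_re.comp h2.matrix_trace))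
  have hSc : IsCompact S := (isCompact_posSemidef_tr _).inter_right hcl
  have h3 : Continuous fun M : Matrix (ι ⊕ ι) (ι ⊕ ι) ℂ => M.toBlocks₂₂ :=
    continuous_matrix fun i j => continuous_id.matrix_elem _ _
  have htr : ∀ A B C D : Matrix ι ι ℂ, tr (fromBlocks A B C D) = tr A + tr D := fun A B C D => by
    simp [tr, Matrix.trace]
  -- The set is the projection to the lower right corner of a compact set of block matrices.
  have : couplingBall ρ r c = (fun M : Matrix (ι ⊕ ι) (ι ⊕ ι) ℂ => M.toBlocks₂₂) '' S := by
    ext τ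
    constructor
    · rintro ⟨hτ, X, hX, hXc⟩
      exact ⟨_, ⟨⟨hX, by rw [htr, hτ]⟩, toBlocks_fromBlocks₁₁ _ _ _ _, by
        rwa [toBlocks_fromBlocks₁₂]⟩, toBlocks_fromBlocks₂₂ _ _ _ _⟩
    · rintro ⟨M, ⟨⟨hM, hMt⟩, rfl, hMc⟩, rfl⟩
      have h21 : M.toBlocks₂₁ = (M.toBlocks₁₂)ᴴ := by
        ext i j
        exact (hM.1.apply (Sum.inr i) (Sum.inl j)).symm
      refine ⟨?_, M.toBlocks₁₂, ?_, hMc⟩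
      · rw [← fromBlocks_toBlocks M, htr, toBlocks_fromBlocks₁₁] at hMt
        linarith
      · rwa [IsCoupling, ← h21, fromBlocks_toBlocks]
  rw [this]
  exact hSc.image h3

end

/-! ### The bound on the smooth max-divergence -/

section

variable {ι : Type*} [Fintype ι] [DecidableEq ι]

/-- The operator with eigenvalues `d` and the columns of the unitary `U` as eigenvectors. -/
def conjDiag (U : Matrix ι ι ℂ) (d : ι → ℝ) : Matrix ι ι ℂ :=
  U * diagonal (fun i => (d i : ℂ)) * Uᴴ

theorem isHermitian_conjDiag (U : Matrix ι ι ℂ) (d : ι → ℝ) : (conjDiag U d).IsHermitian := by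
  rw [IsHermitian, conjDiag, conjTranspose_mul, conjTranspose_mul, conjTranspose_conjTranspose,
    diagonal_conjTranspose, Matrix.mul_assoc]
  congr 3
  ext i
  simp

theorem conjDiag_mul {U : Matrix ι ι ℂ} (hU : Uᴴ * U = 1) (d e : ι → ℝ) :
    conjDiag U d * conjDiag U e = conjDiag U (d * e) := by
  have : conjDiag U d * conjDiag U e = U * diagonal (fun i => (d i : ℂ)) * (Uᴴ * U) *
      diagonal (fun i => (e i : ℂ)) * Uᴴ := by
    simp only [conjDiag, Matrix.mul_assoc]
  rw [this, hU, Matrix.mul_one, Matrix.mul_assoc U, diagonal_mul_diagonal, conjDiag]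
  simp

theorem tr_conjDiag_mul (U : Matrix ι ι ℂ) (d : ι → ℝ) (A : Matrix ι ι ℂ) :
    tr (conjDiag U d * A) = ∑ i, d i * ((Uᴴ * A * U) i i).re := by
  have : (conjDiag U d * A).trace = (diagonal (fun i => (d i : ℂ)) * (Uᴴ * A * U)).trace := by
    rw [conjDiag, Matrix.mul_assoc U, Matrix.mul_assoc U, Matrix.trace_mul_comm]
    simp only [Matrix.mul_assoc]
  rw [tr, this, Matrix.trace, Complex.re_sum]
  exact Finset.sum_congr rfl fun i _ => by
    rw [diag_apply, diagonal_mul, Complex.re_ofReal_mul]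

/-- For a given test `W`, cutting off from `ρ` the eigenvectors of `W` on which `ρ` exceeds `m σ`
and rescaling gives an operator close to `ρ` and, on `W`, below `m / (1 - ε²) σ`. -/
theorem exists_mem_couplingBall {ρ σ W : Matrix ι ι ℂ} (hρ : ρ.PosSemidef) (hr : 0 < tr ρ)
    (hσ : σ.PosSemidef) (h : SuppLE ρ σ) (hW : W.PosSemidef) {α ε m : ℝ} (hα : 1 < α)
    (hε0 : 0 < ε) (hε1 : ε < 1) (hm : 0 < m)
    (hmQ : m ^ (-(α - 1)) * sandwichedTrace α ρ σ = ε ^ 2 * tr ρ) :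
    ∃ τ ∈ couplingBall ρ (tr ρ) (tr ρ * Real.sqrt (1 - ε ^ 2)),
      tr (W * τ) ≤ tr (W * ((m / (1 - ε ^ 2)) • σ)) := by
  have hε : 0 < 1 - ε ^ 2 := by nlinarith
  set U := eigU hW.1 with hU
  have hUU : Uᴴ * U = 1 := eigU_conjTranspose_mul_self hW.1
  have hUU' : U * Uᴴ = 1 := eigU_mul_conjTranspose hW.1
  set w := hW.1.eigenvalues with hw
  have hw0 : ∀ i, 0 ≤ w i := hW.eigenvalues_nonneg
  have hWU : W = conjDiag U w := by
    rw [conjDiag, hU, hw, ← cfc_eq_eigU hW.1 fun x => x, cfc_self hW.1]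
  set p : ι → ℝ := fun i => ((Uᴴ * ρ * U) i i).re with hp
  set q : ι → ℝ := fun i => ((Uᴴ * σ * U) i i).re with hq
  have hq0 : ∀ i, 0 ≤ q i := fun i => re_diag_nonneg (hσ.conjTranspose_mul_mul_same U) i
  set g : ι → ℝ := fun i => if p i ≤ m * q i then 1 else 0 with hg
  have hgg : g * g = g := by
    ext i; simp only [hg, Pi.mul_apply]; split_ifs <;> simp
  set b : ι → ℝ := 1 - g with hb
  have hbb : b * b = b := by
    rw [hb, mul_sub, sub_mul, sub_mul, hgg]; simp
  have htr : tr (conjDiag U b * ρ) ≤ ε ^ 2 * tr ρ := by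
    rw [← hmQ]
    refine tr_mul_le_of_le hρ hσ h (isHermitian_conjDiag U b) ?_ hα hm ?_
    · rw [conjDiag_mul hUU, hbb]
    · rw [tr_conjDiag_mul, tr_conjDiag_mul, Finset.mul_sum]
      refine Finset.sum_le_sum fun i _ => ?_
      by_cases hi : p i ≤ m * q i
      · simp [hb, hg, hi]
      · have : b i = 1 := by simp [hb, hg, hi]
        rw [this, one_mul, one_mul]
        exact (not_le.1 hi).le
  set E := conjDiag U g with hE
  have hEh : Eᴴ = E := isHermitian_conjDiag U g
  have hEE : E * E = E := by rw [hE, conjDiag_mul hUU, hgg]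
  set t := tr (E * ρ) with ht
  have hsum : t + tr (conjDiag U b * ρ) = tr ρ := by
    rw [ht, tr_conjDiag_mul, tr_conjDiag_mul, ← Finset.sum_add_distrib, tr_eq_sum_diag hUU']
    exact Finset.sum_congr rfl fun i _ => by simp only [hb, Pi.sub_apply, Pi.one_apply]; ring
  have ht1 : tr ρ * (1 - ε ^ 2) ≤ t := by linarith
  have ht0 : 0 < t := lt_of_lt_of_le (by positivity) ht1
  set k := tr ρ / t with hk
  have hk0 : 0 < k := by positivity
  have hkt : k * t = tr ρ := by rw [hk]; field_simp
  have hEρE : tr (E * ρ * E) = t := by rw [tr_mul_comm, ← Matrix.mul_assoc, hEE]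
  refine ⟨k • (E * ρ * E), ⟨by rw [tr_smul, hEρE, hkt], Real.sqrt k • (ρ * E), ?_, ?_⟩, ?_⟩
  · have := posSemidef_fromBlocks_conj hρ 1 (Real.sqrt k • E)
    have e : Real.sqrt k • Real.sqrt k • (E * ρ * E) = k • (E * ρ * E) := by
      rw [smul_smul, Real.mul_self_sqrt hk0.le]
    simpa only [IsCoupling, conjTranspose_smul, conjTranspose_mul, conjTranspose_one, star_trivial,
      hEh, hρ.1.eq, Matrix.one_mul, Matrix.mul_one, Matrix.smul_mul, Matrix.mul_smul, e] using this
  · rw [tr_smul, tr_mul_comm, ← ht]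
    have h1 : tr ρ = Real.sqrt (k * t) * Real.sqrt (tr ρ) := by
      rw [hkt, Real.mul_self_sqrt hr.le]
    calc tr ρ * Real.sqrt (1 - ε ^ 2)
        = Real.sqrt (k * t) * Real.sqrt (tr ρ * (1 - ε ^ 2)) := by
          rw [Real.sqrt_mul hr.le, ← mul_assoc, ← h1]
      _ ≤ Real.sqrt (k * t) * Real.sqrt t := by gcongr
      _ = Real.sqrt k * t := by
          rw [Real.sqrt_mul hk0.le, mul_assoc, Real.mul_self_sqrt ht0.le]
  · have hkε : k ≤ 1 / (1 - ε ^ 2) := by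
      rw [hk, div_le_div_iff₀ ht0 hε]; linarith
    have e1 : tr (W * (E * ρ * E)) = ∑ i, g i * w i * p i := by
      have : tr (W * (E * ρ * E)) = tr (E * W * E * ρ) := by
        rw [← Matrix.mul_assoc, tr_mul_comm]
        simp only [Matrix.mul_assoc]
      rw [this, hWU, hE, conjDiag_mul hUU, conjDiag_mul hUU, tr_conjDiag_mul,
        mul_right_comm g w g, hgg]
      rfl
    have e2 : tr (W * σ) = ∑ i, w i * q i := by
      conv_lhs => rw [hWU]
      rw [tr_conjDiag_mul]
    rw [Matrix.mul_smul, Matrix.mul_smul, tr_smul, tr_smul, e1, e2, div_eq_mul_one_div m,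
      mul_comm m, mul_assoc, Finset.mul_sum (a := m)]
    -- Eigenvectors kept by `E` satisfy `p i ≤ m * q i`; the others contribute nothing on the left.
    refine mul_le_mul hkε (Finset.sum_le_sum fun i _ => ?_) (Finset.sum_nonneg fun i _ => ?_)
      (by positivity)
    · by_cases hi : p i ≤ m * q i
      · have : g i = 1 := by simp [hg, hi]
        rw [this, one_mul]
        nlinarith [mul_le_mul_of_nonneg_left hi (hw0 i)]
      · have : g i = 0 := by simp [hg, hi]
        rw [this, zero_mul, zero_mul]
        have := hw0 i; have := hq0 i
        positivity
    · have h1 : 0 ≤ g i := by simp only [hg]; split_ifs <;> norm_num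
      have h2 : 0 ≤ p i := re_diag_nonneg (hρ.conjTranspose_mul_mul_same U) i
      have := hw0 i
      positivity

theorem couplingBall_subset_ballP {ρ : Matrix ι ι ℂ} (hρ : IsSubState ρ) {ε : ℝ} (hε0 : 0 < ε)
    (hε1 : ε < 1) :
    couplingBall ρ (tr ρ) (tr ρ * Real.sqrt (1 - ε ^ 2)) ⊆ ballP ε ρ := by
  rintro τ ⟨hτ, X, hX, hXc⟩
  have hε : 0 < 1 - ε ^ 2 := by nlinarith
  refine ⟨⟨hX.posSemidef_right, hτ ▸ hρ.2.1, hτ ▸ hρ.2.2⟩, ?_⟩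
  have h1 := hXc.trans (hX.tr_le_traceNorm hρ.1 hX.posSemidef_right)
  have hs1 : Real.sqrt (1 - ε ^ 2) ≤ 1 := Real.sqrt_le_one.2 (by nlinarith)
  have hs0 := Real.sqrt_nonneg (1 - ε ^ 2)
  have h2 : 1 - ε ^ 2 ≤ genFidelity ρ τ := by
    rw [genFidelity, hτ, Real.sqrt_mul_self (sub_nonneg.2 hρ.2.2)]
    calc 1 - ε ^ 2 = Real.sqrt (1 - ε ^ 2) ^ 2 := (Real.sq_sqrt hε.le).symm
      _ ≤ _ := by
        gcongr
        have := mul_le_mul_of_nonneg_left hs1 (sub_nonneg.2 hρ.2.2)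
        linarith
  rw [purifiedDist, Real.sqrt_le_left hε0.le]
  linarith

theorem couplingBall_subset_ballT {ρ : Matrix ι ι ℂ} (hρ : IsState ρ) {ε : ℝ} (hε0 : 0 < ε)
    (hε1 : ε < 1) :
    couplingBall ρ (tr ρ) (tr ρ * Real.sqrt (1 - ε ^ 2)) ⊆ ballT ε ρ := by
  rintro τ ⟨hτ, X, hX, hXc⟩
  have hε : 0 < 1 - ε ^ 2 := by nlinarith
  have hτs : IsState τ := ⟨hX.posSemidef_right, hτ.trans hρ.2⟩
  refine ⟨hτs, (hX.traceDist_le hρ hτs).trans ?_⟩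
  rw [hρ.2, one_mul] at hXc
  rw [Real.sqrt_le_left hε0.le]
  have := (Real.sqrt_le_iff.1 hXc)
  linarith [this.2]

/-- Both smoothed divergences are bounded through the common ball of coupled operators. -/
theorem dMaxOn_couplingBall_le {ρ σ : Matrix ι ι ℂ} (hρ : ρ.PosSemidef) (hr : 0 < tr ρ)
    (hσ : σ.PosSemidef) {ε : ℝ} (hε0 : 0 < ε) (hε1 : ε < 1) {α : ℝ} (hα : 1 < α) :
    dMaxOn (couplingBall ρ (tr ρ) (tr ρ * Real.sqrt (1 - ε ^ 2))) σ ≤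
      sandwichedRenyi α ρ σ + ((1 / (α - 1) * Real.logb 2 (1 / ε ^ 2) : ℝ) : EReal)
        + ((Real.logb 2 (1 / (1 - ε ^ 2)) : ℝ) : EReal) := by
  by_cases h : SuppLE ρ σ
  swap
  · rw [sandwichedRenyi, if_neg h, EReal.top_add_coe, EReal.top_add_coe]
    exact le_top
  have hε : 0 < 1 - ε ^ 2 := by nlinarith
  have hα1 : 0 < α - 1 := by linarith
  set Q := sandwichedTrace α ρ σ with hQ
  have hQ0 : 0 < Q := sandwichedTrace_pos hρ hσ h hα hr
  set m := (Q / (ε ^ 2 * tr ρ)) ^ (1 / (α - 1)) with hm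
  have hm0 : 0 < m := by positivity
  have hmQ : m ^ (-(α - 1)) * Q = ε ^ 2 * tr ρ := by
    rw [hm, ← Real.rpow_mul (by positivity)]
    have : 1 / (α - 1) * (-(α - 1)) = -1 := by field_simp
    rw [this, Real.rpow_neg_one]
    field_simp
  obtain ⟨τ, hτ, hle⟩ := exists_le_of_forall_tr_mul_le (T := (m / (1 - ε ^ 2)) • σ)
    (convex_couplingBall ρ (tr ρ) (tr ρ * Real.sqrt (1 - ε ^ 2))) (isCompact_couplingBall _ _ _)
    (fun τ hτ => by obtain ⟨-, X, hX, -⟩ := hτ; exact hX.posSemidef_right.1)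
    (hσ.smul (by positivity)).1
    (fun W hW => exists_mem_couplingBall hρ hr hσ h hW hα hε0 hε1 hm0 hmQ)
  set l := Real.logb 2 (m / (1 - ε ^ 2)) with hl
  have h2l : (2 : ℝ) ^ l = m / (1 - ε ^ 2) :=
    Real.rpow_logb (by norm_num) (by norm_num) (by positivity)
  have hle' : dMaxOn (couplingBall ρ (tr ρ) (tr ρ * Real.sqrt (1 - ε ^ 2))) σ ≤ (l : EReal) :=
    (iInf₂_le τ hτ).trans (iInf₂_le l (by rwa [h2l]))
  refine hle'.trans_eq ?_
  rw [sandwichedRenyi, if_pos h, ← EReal.coe_add, ← EReal.coe_add]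
  congr 1
  change l = 1 / (α - 1) * Real.logb 2 (Q / tr ρ) + _ + _
  rw [hl, div_eq_mul_one_div m, Real.logb_mul hm0.ne' (by positivity), hm,
    Real.logb_rpow_eq_mul_logb_of_pos (by positivity), ← mul_add,
    ← Real.logb_mul (by positivity) (by positivity)]
  congr 4
  field_simp

end

end QDiv

theorem theorem1 {ι : Type*} [Fintype ι] [DecidableEq ι] (ρ σ : Matrix ι ι ℂ)
    (hρ : QDiv.IsSubState ρ) (hσ : σ.PosSemidef)
    (ε : ℝ) (hε0 : 0 < ε) (hε1 : ε < 1) (α : ℝ) (hα : 1 < α) :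
    QDiv.dMaxP ε ρ σ ≤
        QDiv.sandwichedRenyi α ρ σ
          + ((1 / (α - 1) * Real.logb 2 (1 / ε ^ 2) : ℝ) : EReal)
          + ((Real.logb 2 (1 / (1 - ε ^ 2)) : ℝ) : EReal) ∧
      (QDiv.IsState ρ →
        QDiv.dMaxT ε ρ σ ≤
          QDiv.sandwichedRenyi α ρ σ
            + ((1 / (α - 1) * Real.logb 2 (1 / ε ^ 2) : ℝ) : EReal)
            + ((Real.logb 2 (1 / (1 - ε ^ 2)) : ℝ) : EReal)) := by
  have key := QDiv.dMaxOn_couplingBall_le hρ.1 hρ.2.1 hσ hε0 hε1 hα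
  exact ⟨(biInf_mono (QDiv.couplingBall_subset_ballP hρ hε0 hε1)).trans key,
    fun h => (biInf_mono (QDiv.couplingBall_subset_ballT h hε0 hε1)).trans key⟩
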